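/- Let $K$ be a field, let $k\ge 3$, and let $0=a_0<a_1<\cdots<a_k=:d$ be integers with $\gcd(a_1,\dots,a_k)=1$. Let $S\subset\mathbb N^2$ be the additive semigroup (with $0$) generated by $(a_j,d-a_j)$, $0\le j\le k$, and let $K[S]$ be its semigroup ring, graded by $\deg(u_1,u_2)=(u_1+u_2)/d$, with maximal homogeneous ideal $\mathfrak m=K[S\setminus\{0\}]$. Put $$a_1(K[S])=\sup\{n\in\mathbb Z\mid H^1_{\mathfrak m}(K[S])_n\ne 0\}\in\mathbb Z\cup\{\pm\infty\},$$ where $H^1_{\mathfrak m}$ denotes the first local cohomology module (and $\sup\emptyset=-\infty$). Let $A_1=\{a_1,\dots,a_k\}$ and $A_2=\{d-a_{k-1},\dots,d-a_1,d\}$. For $s=1,2$ let $\langle A_s\rangle\subseteq\mathbb N$ be the semigroup (with $0$) generated by $A_s$; for an integer $i$ with $1\le i\le d-1$ let $\omega_s(i)$ be the least element of $\langle A_s\rangle$ congruent to $i$ modulo $d$; and for $n\in\langle A_s\rangle$ let $\delta_s(n)$ be the least value of $\sum_{\alpha\in A_s}x_\alpha$ over all $(x_\alpha)\in\mathbb N^{A_s}$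 with $n=\sum_{\alpha\in A_s} x_\alpha\alpha$. For $1\le i\le d-1$ put $w_i=(\omega_1(i),\omega_2(d-i))$, $\delta_1(w_i)=\delta_1(\omega_1(i))$, $\delta_2(w_i)=\delta_2(\omega_2(d-i))$, $\deg(w_i)=(\omega_1(i)+\omega_2(d-i))/d$, and let $$\mathbb I=\{\,1\le i\le d-1\mid i\notin\{a_1,\dots,a_{k-1}\},\ \delta_1(w_i)>\deg(w_i)\,\}.$$ Assume that $\mathbb I\ne\emptyset$. Then: (i) $\displaystyle a_1(K[S])\ \ge\ \max_{i\in\mathbb I}\max\{\delta_1(w_i),\delta_2(w_i)\}-1$; (ii) $\displaystyle a_1(K[S])\ \le\ \max_{i\in\mathbb I}\bigl(\delta_1(w_i)+\delta_2(w_i)-\deg(w_i)\bigr)-2$; (iii) $\displaystyle a_1(K[S])\ \le\ \left\lfloor\Bigl(1-\frac{a_1}{d}\Bigr)\max_{i\in\mathbb I}\delta_1(w_i)+\frac{a_{k-1}}{d}\max_{i\in\mathbb I}\delta_2(w_i)\right\rfloor-2.$ -/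

import Mathlib

noncomputable section

/-! ### First local cohomology of a graded ring through the Čech complex -/

namespace Cech

variable {R : Type*} [CommRing R]

/-- The canonical map `R_f → R_g` of `R`-algebras, for `f ∣ g`. -/
def awayMap {f g : R} (h : f ∣ g) : Localization.Away f →ₐ[R] Localization.Away g :=
  IsLocalization.liftAlgHom (M := Submonoid.powers f)
    (f := Algebra.ofId R (Localization.Away g)) (by
      rintro ⟨_, n, rfl⟩
      have hg : IsUnit (algebraMap R (Localization.Away g) g) :=
        IsLocalization.Away.algebraMap_isUnit g
      have hf : IsUnit (algebraMap R (Localization.Away g) f) :=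
        isUnit_of_dvd_unit (map_dvd _ h) hg
      simpa [Algebra.ofId_apply] using hf.pow n)

variable {ι : Type*} [LinearOrder ι] (x : ι → R)

/-- The Čech differential `C⁰ = R → C¹ = ∏ i, R_{x i}`. -/
def d0 : R →ₗ[R] (∀ i, Localization.Away (x i)) :=
  LinearMap.pi fun i => Algebra.linearMap R (Localization.Away (x i))

/-- The Čech differential `C¹ = ∏ i, R_{x i} → C² = ∏ i < j, R_{x i * x j}`,
`(c i) ↦ (c j - c i)`. -/
def d1 : (∀ i, Localization.Away (x i)) →ₗ[R]
    (∀ p : {p : ι × ι // p.1 < p.2}, Localization.Away (x p.1.1 * x p.1.2)) :=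
  LinearMap.pi fun p =>
    (awayMap (dvd_mul_left (x p.1.2) (x p.1.1))).toLinearMap ∘ₗ LinearMap.proj p.1.2 -
      (awayMap (dvd_mul_right (x p.1.1) (x p.1.2))).toLinearMap ∘ₗ LinearMap.proj p.1.1

theorem d1_comp_d0 : d1 x ∘ₗ d0 x = 0 := by
  ext p
  simp [d0, d1]

/-- The first cohomology of the complex `R → ∏ i, R_{x i} → ∏ i < j, R_{x i * x j}`: when `R` is
noetherian and the finite family `x` generates the ideal `𝔪`, this is the local cohomology
module `H¹_𝔪(R)`. -/
abbrev H1 : Type _ :=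
  LinearMap.ker (d1 x) ⧸ (LinearMap.range (d0 x)).comap (LinearMap.ker (d1 x)).subtype

section Graded

variable {σ : Type*} [SetLike σ R] [AddSubgroupClass σ R] (𝒜 : ℤ → σ) [SetLike.GradedMonoid 𝒜]

/-- The elements of degree `n` of `R_f`, for `f` homogeneous of degree `e`: those of the
form `r / f ^ m` with `r` homogeneous of degree `n + m * e`. -/
def awayPiece {f : R} {e : ℤ} (hf : f ∈ 𝒜 e) (n : ℤ) : AddSubgroup (Localization.Away f) where
  carrier := {z | ∃ (m : ℕ) (r : R), r ∈ 𝒜 (n + m * e) ∧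
    z * algebraMap R (Localization.Away f) (f ^ m) = algebraMap R (Localization.Away f) r}
  zero_mem' := ⟨0, 0, zero_mem _, by simp⟩
  neg_mem' := by
    rintro z ⟨m, r, hr, h⟩
    exact ⟨m, -r, neg_mem hr, by rw [neg_mul, h, map_neg]⟩
  add_mem' := by
    rintro z w ⟨m, r, hr, h⟩ ⟨m', r', hr', h'⟩
    have key : ∀ (p q : ℕ) (s : R), s ∈ 𝒜 (n + p * e) → f ^ q * s ∈ 𝒜 (n + (p + q : ℕ) * e) := by
      intro p q s hs
      have h1 := SetLike.mul_mem_graded (SetLike.pow_mem_graded q hf) hs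
      have h2 : q • e + (n + p * e) = n + ((p + q : ℕ) : ℤ) * e := by
        push_cast [nsmul_eq_mul]; ring
      rwa [h2] at h1
    refine ⟨m + m', f ^ m' * r + f ^ m * r', add_mem (key m m' r hr) ?_, ?_⟩
    · have := key m' m r' hr'
      rwa [Nat.add_comm m' m] at this
    · rw [map_add, map_mul, map_mul, ← h, ← h', pow_add, map_mul]
      ring

/-- The homogeneous component of degree `n` of `H1 x`, for `x i` homogeneous of degree `e i`: the
classes of the cocycles all of whose entries are homogeneous of degree `n`. -/
def H1Piece {e : ι → ℤ} (hx : ∀ i, x i ∈ 𝒜 (e i)) (n : ℤ) : AddSubgroup (H1 x) :=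
  ((AddSubgroup.pi Set.univ fun i => awayPiece 𝒜 (hx i) n).comap
      (LinearMap.ker (d1 x)).subtype.toAddMonoidHom).map
    ((LinearMap.range (d0 x)).comap (LinearMap.ker (d1 x)).subtype).mkQ.toAddMonoidHom

/-- `sup {n | H¹_n ≠ 0}`, as an extended real number (`-∞` if `H¹ = 0`). -/
def aOne {e : ι → ℤ} (hx : ∀ i, x i ∈ 𝒜 (e i)) : EReal :=
  sSup {r : EReal | ∃ n : ℤ, H1Piece x 𝒜 hx n ≠ ⊥ ∧ r = ((n : ℝ) : EReal)}

end Graded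

end Cech

/-! ### Apéry sets and degrees in numerical semigroups -/

namespace NumSgp

/-- The least element of the semigroup generated by `A` that is congruent to `i` modulo `m`. -/
def omega (A : Finset ℕ) (m i : ℕ) : ℕ :=
  sInf {n | n ∈ AddSubmonoid.closure (A : Set ℕ) ∧ n ≡ i [MOD m]}

/-- The degree of `n` with respect to `A`: the least number of summands, counted with
multiplicity, in an expression of `n` as a sum of elements of `A`. It is only used for `n` in the
semigroup generated by `A`. -/
def delta (A : Finset ℕ) (n : ℕ) : ℕ :=
  sInf {s | ∃ c : ℕ → ℕ, n = ∑ α ∈ A, c α * α ∧ s = ∑ α ∈ A, c α}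

end NumSgp

/-! ### Projective monomial curves

The sequence `0 = a 0 < a 1 < ⋯ < a k = d` is a function on `Fin (k + 1)`. -/

namespace MonomialCurve

variable {k : ℕ} (a : Fin (k + 1) → ℕ)

/-- `d = a k`. -/
abbrev d : ℕ := a (Fin.last k)

/-- The point `(a j, d - a j)`. -/
def e (j : Fin (k + 1)) : ℕ × ℕ := (a j, d a - a j)

/-- The semigroup generated by the points `(a j, d - a j)`. -/
def S : AddSubmonoid (ℕ × ℕ) := AddSubmonoid.closure (Set.range (e a))

/-- The set `{a 1, …, a k}`. -/
def A1 : Finset ℕ := (Finset.univ.image a).erase 0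

/-- The set `{d - a (k - 1), …, d - a 1, d}`. -/
def A2 : Finset ℕ := (Finset.univ.image fun j => d a - a j).erase 0

/-- The degree `(u₁ + u₂) / d` of a point. -/
def deg (u : ℕ × ℕ) : ℝ := ((u.1 : ℝ) + (u.2 : ℝ)) / (d a : ℝ)

/-- The point `(ω₁(i), ω₂(d - i))`. -/
def w (i : ℕ) : ℕ × ℕ := (NumSgp.omega (A1 a) (d a) i, NumSgp.omega (A2 a) (d a) (d a - i))

/-- `δ₁` of a point: the degree of its first coordinate with respect to `{a 1, …, a k}`. -/
def delta1 (u : ℕ × ℕ) : ℕ := NumSgp.delta (A1 a) u.1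

/-- `δ₂` of a point: the degree of its second coordinate with respect to
`{d - a (k - 1), …, d - a 1, d}`. -/
def delta2 (u : ℕ × ℕ) : ℕ := NumSgp.delta (A2 a) u.2

open Classical in
/-- The set `𝕀` of all `i` with `1 ≤ i ≤ d - 1`, different from every `a j`, such that
`δ₁(w i) > deg (w i)`. -/
def I : Finset ℕ :=
  (Finset.Icc 1 (d a - 1)).filter fun i => (∀ j, i ≠ a j) ∧ deg a (w a i) < (delta1 a (w a i) : ℝ)

variable (K : Type*) [Field K]

/-- The semigroup ring `K[S]`. -/
abbrev Ring : Type _ := AddMonoidAlgebra K (S a)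

/-- The homogeneous elements of degree `n` of `K[S]`: the linear combinations of the `u ∈ S`
with `deg u = n`. -/
def grading (n : ℤ) : Submodule K (Ring a K) :=
  AddMonoidAlgebra.gradeBy K (fun u : S a => deg a (u : ℕ × ℕ)) (n : ℝ)

instance : SetLike.GradedMonoid (grading a K) where
  one_mem := by
    have h := AddMonoidAlgebra.single_mem_gradeBy
      (fun u : S a => deg a (u : ℕ × ℕ)) (0 : S a) (1 : K)
    have h0 : deg a (((0 : S a)) : ℕ × ℕ) = ((0 : ℤ) : ℝ) := by simp [deg]
    simp only [h0] at h
    exact h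
  mul_mem i j p q hp hq := by
    let f : S a →+ ℝ :=
      { toFun := fun u => deg a (u : ℕ × ℕ)
        map_zero' := by simp [deg]
        map_add' := fun u v => by simp [deg]; ring }
    have h := SetLike.mul_mem_graded (A := AddMonoidAlgebra.gradeBy K f)
      (i := (i : ℝ)) (j := (j : ℝ)) hp hq
    have h' : grading a K (i + j) = AddMonoidAlgebra.gradeBy K f ((i : ℝ) + (j : ℝ)) := by
      unfold grading
      rw [Int.cast_add]
      rfl
    rw [h']
    exact h

/-- The monomial of `K[S]` with exponent `(a j, d - a j)`. -/
def gen (j : Fin (k + 1)) : Ring a K :=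
  AddMonoidAlgebra.single ⟨e a j, AddSubmonoid.subset_closure ⟨j, rfl⟩⟩ 1

variable {a} in
theorem gen_mem (ha : StrictMono a) (h0 : a 0 = 0) (hd : 1 ≤ k) (j : Fin (k + 1)) :
    gen a K j ∈ grading a K 1 := by
  have h := AddMonoidAlgebra.single_mem_gradeBy (fun u : S a => deg a (u : ℕ × ℕ))
    ⟨e a j, AddSubmonoid.subset_closure ⟨j, rfl⟩⟩ (1 : K)
  have hj : a j ≤ d a := ha.monotone (Fin.le_last j)
  have hpos : 0 < d a := by
    rw [← h0]
    exact ha (by rw [Fin.lt_def]; simpa using Nat.lt_of_lt_of_le Nat.zero_lt_one hd)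
  have h1 : deg a (e a j) = ((1 : ℤ) : ℝ) := by
    have : (d a : ℝ) ≠ 0 := by exact_mod_cast hpos.ne'
    simp only [deg, e, Nat.cast_sub hj]
    field_simp
    push_cast
    ring
  simp only [h1] at h
  exact h

/-- The maximal homogeneous ideal of `K[S]`, spanned by the monomials with exponent `≠ 0`. -/
def maxIdeal : Ideal (Ring a K) :=
  Ideal.span {p | ∃ u : S a, u ≠ 0 ∧ p = AddMonoidAlgebra.single u 1}

variable {a} in
/-- The monomials `gen` generate the maximal homogeneous ideal, so that their Čech complex
computes the local cohomology with support in it. -/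
theorem span_gen (ha : StrictMono a) (h0 : a 0 = 0) (hd : 1 ≤ k) :
    Ideal.span (Set.range (gen a K)) = maxIdeal a K := by
  apply le_antisymm
  · rw [Ideal.span_le]
    rintro _ ⟨j, rfl⟩
    refine Ideal.subset_span ⟨⟨e a j, AddSubmonoid.subset_closure ⟨j, rfl⟩⟩, ?_, rfl⟩
    intro hz
    have hpos : 0 < d a := by
      rw [← h0]
      exact ha (by rw [Fin.lt_def]; simpa using Nat.lt_of_lt_of_le Nat.zero_lt_one hd)
    have hz' : e a j = 0 := congrArg Subtype.val hz
    have h1 : a j = 0 := congrArg Prod.fst hz'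
    have h2 : d a - a j = 0 := congrArg Prod.snd hz'
    omega
  · rw [maxIdeal, Ideal.span_le]
    rintro _ ⟨⟨u, hu⟩, hne, rfl⟩
    have key : ∀ (v : ℕ × ℕ) (hv : v ∈ S a), v = 0 ∨
        AddMonoidAlgebra.single (⟨v, hv⟩ : S a) (1 : K) ∈ Ideal.span (Set.range (gen a K)) := by
      intro v hv
      induction hv using AddSubmonoid.closure_induction with
      | mem v hv =>
        obtain ⟨j, rfl⟩ := hv
        exact Or.inr (Ideal.subset_span ⟨j, rfl⟩)
      | zero => exact Or.inl rfl
      | add v v' hv hv' ih ih' =>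
        have hmul : AddMonoidAlgebra.single (⟨v + v', add_mem hv hv'⟩ : S a) (1 : K) =
            AddMonoidAlgebra.single (⟨v, hv⟩ : S a) 1 *
              AddMonoidAlgebra.single (⟨v', hv'⟩ : S a) 1 := by
          rw [AddMonoidAlgebra.single_mul_single, one_mul]
          rfl
        rcases ih with rfl | ih
        · rcases ih' with rfl | ih'
          · exact Or.inl (add_zero 0)
          · right
            rw [hmul]
            exact Ideal.mul_mem_left _ _ ih'
        · right
          rw [hmul]
          exact Ideal.mul_mem_right _ _ ih
    rcases key u hu with rfl | h
    · exact absurd rfl hne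
    · exact h

variable {a} in
/-- `a₁(K[S])`, the supremum of the degrees `n` with `H¹_𝔪(K[S])_n ≠ 0`. -/
def aOne (ha : StrictMono a) (h0 : a 0 = 0) (hd : 1 ≤ k) : EReal :=
  Cech.aOne (gen a K) (grading a K) (fun j => gen_mem K ha h0 hd j)

end MonomialCurve

end

/-! Let `S'` be the set of points u with u₁ ∈ ⟨A₁⟩, u₂ ∈ ⟨A₂⟩ and d ∣ u₁ + u₂. The Čech complex
shows that H¹ is nonzero in degree n exactly when some u ∈ S' \ S has degree n (`H1Piece_ne_bot`,
`exists_mem_S'_of_H1Piece_ne_bot`), so a₁(K[S]) is the supremum of the degrees on S' \ S.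

Membership is controlled by δ: a point u ∈ S' of degree D lies in S iff δ₁(u) ≤ D, since a shorter
expression of u₁ can be padded with copies of e₀ = (0, d); symmetrically iff δ₂(u) ≤ D, padding with
e_k = (d, 0). Moreover u = w i + α e_k + β e₀ with i ∈ 𝕀 for every u ∈ S' \ S (`exists_eq_w_add`).

For (i), adding copies of e₀ to w i leaves δ₁ fixed, and the point stays outside S up to degree δ₁(w
i) - 1; likewise with e_k and δ₂. For (ii), deg u < δ₁(w i) + α and deg u < δ₂(w i) + β bound β and
α. Then (iii) follows from (ii), because a₁ and d - a_{k-1} are the least generators, and degrees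
are integers. -/

noncomputable section

/-! ### Numerical semigroups: lengths of expressions and Apéry elements. -/

namespace NumSgp

variable {A : Finset ℕ} {m n : ℕ}

theorem sum_mul_mem_closure (c : ℕ → ℕ) :
    ∑ α ∈ A, c α * α ∈ AddSubmonoid.closure (A : Set ℕ) :=
  sum_mem fun α hα => by
    rw [← smul_eq_mul]
    exact nsmul_mem (AddSubmonoid.subset_closure hα) _

theorem exists_sum_eq (hn : n ∈ AddSubmonoid.closure (A : Set ℕ)) :
    ∃ c : ℕ → ℕ, n = ∑ α ∈ A, c α * α := by
  induction hn using AddSubmonoid.closure_induction with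
  | mem α hα =>
    refine ⟨Pi.single α 1, ?_⟩
    rw [Finset.sum_eq_single_of_mem α hα fun β _ hβ => by simp [hβ]]
    simp
  | zero => exact ⟨0, by simp⟩
  | add n n' _ _ ih ih' =>
    obtain ⟨c, rfl⟩ := ih
    obtain ⟨c', rfl⟩ := ih'
    exact ⟨c + c', by simp [add_mul, Finset.sum_add_distrib]⟩

theorem delta_sum_le (c : ℕ → ℕ) : delta A (∑ α ∈ A, c α * α) ≤ ∑ α ∈ A, c α :=
  Nat.sInf_le ⟨c, rfl, rfl⟩

theorem exists_sum_eq_delta (hn : n ∈ AddSubmonoid.closure (A : Set ℕ)) :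
    ∃ c : ℕ → ℕ, n = ∑ α ∈ A, c α * α ∧ delta A n = ∑ α ∈ A, c α := by
  obtain ⟨c, hc⟩ := exists_sum_eq hn
  exact Nat.sInf_mem (s := {s | ∃ c : ℕ → ℕ, n = ∑ α ∈ A, c α * α ∧ s = ∑ α ∈ A, c α})
    ⟨_, c, hc, rfl⟩

theorem delta_add_mul_le {α : ℕ} (hα : α ∈ A) (hn : n ∈ AddSubmonoid.closure (A : Set ℕ))
    (m : ℕ) : delta A (n + m * α) ≤ delta A n + m := by
  obtain ⟨c, hc, hd⟩ := exists_sum_eq_delta hn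
  have h := delta_sum_le (A := A) (c + Pi.single α m)
  have h1 : ∑ β ∈ A, (Pi.single α m : ℕ → ℕ) β = m := by
    rw [Finset.sum_eq_single_of_mem α hα fun β _ hβ => by simp [hβ]]
    simp
  have h2 : ∑ β ∈ A, (Pi.single α m : ℕ → ℕ) β * β = m * α := by
    rw [Finset.sum_eq_single_of_mem α hα fun β _ hβ => by simp [hβ]]
    simp
  simpa [add_mul, Finset.sum_add_distrib, h1, h2, ← hc, ← hd] using h

theorem mul_delta_le {b : ℕ} (hA : ∀ α ∈ A, b ≤ α)
    (hn : n ∈ AddSubmonoid.closure (A : Set ℕ)) : b * delta A n ≤ n := by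
  obtain ⟨c, hc, hd⟩ := exists_sum_eq_delta hn
  rw [hd]
  conv_rhs => rw [hc]
  rw [Finset.mul_sum]
  refine Finset.sum_le_sum fun α hα => ?_
  rw [mul_comm]
  exact Nat.mul_le_mul_left _ (hA α hα)

theorem omega_mem (hA : Nat.setGcd (A : Set ℕ) = 1) (hm : 0 < m) (i : ℕ) :
    omega A m i ∈ AddSubmonoid.closure (A : Set ℕ) ∧ omega A m i ≡ i [MOD m] := by
  obtain ⟨N, hN⟩ := Nat.exists_mem_closure_of_ge (s := (A : Set ℕ))
  refine Nat.sInf_mem (s := {n | n ∈ AddSubmonoid.closure (A : Set ℕ) ∧ n ≡ i [MOD m]})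
    -- With gcd 1 the semigroup contains every integer from `N` on, so the set whose infimum is
    -- taken is nonempty.
    ⟨i + N * m, hN _ ?_ (by simp [hA]), by simp [Nat.ModEq]⟩
  nlinarith

theorem omega_le (hn : n ∈ AddSubmonoid.closure (A : Set ℕ)) {i : ℕ} (hi : n ≡ i [MOD m]) :
    omega A m i ≤ n :=
  Nat.sInf_le ⟨hn, hi⟩

theorem omega_eq_self {α : ℕ} (hα : α ∈ A) (hm : α < m) (hA : Nat.setGcd (A : Set ℕ) = 1) :
    omega A m α = α := by
  have h1 := omega_le (AddSubmonoid.subset_closure hα) (Nat.ModEq.refl (n := m) α)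
  have h2 := (omega_mem hA (by omega) α (m := m)).2
  exact h2.eq_of_lt_of_lt (by omega) hm

/-- Points of the semigroup generated by the `(α, d - α)`, `α ∈ A ∪ {0}`. -/
theorem mem_closure_image_iff {d : ℕ} (hA : ∀ α ∈ A, α ≤ d) {u : ℕ × ℕ} :
    u ∈ AddSubmonoid.closure ((fun α => ((α, d - α) : ℕ × ℕ)) '' (insert 0 (A : Set ℕ))) ↔
      u.1 ∈ AddSubmonoid.closure (A : Set ℕ) ∧
        ∃ D, u.1 + u.2 = D * d ∧ delta A u.1 ≤ D := by
  constructor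
  · intro hu
    -- `delta` is only subadditive, so the induction carries explicit coefficients instead.
    suffices ∃ (c : ℕ → ℕ) (D : ℕ), u.1 = ∑ α ∈ A, c α * α ∧ ∑ α ∈ A, c α ≤ D ∧
        u.1 + u.2 = D * d by
      obtain ⟨c, D, h1, h2, h3⟩ := this
      refine ⟨h1 ▸ sum_mul_mem_closure c, D, h3, ?_⟩
      rw [h1]
      exact (delta_sum_le c).trans h2
    induction hu using AddSubmonoid.closure_induction with
    | mem u hu =>
      obtain ⟨α, rfl | hα, rfl⟩ := hu
      -- The generator (0, d) raises `D` without using any summand; hence an inequality rather than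
      -- an equality.
      · exact ⟨0, 1, by simp⟩
      · refine ⟨Pi.single α 1, 1, ?_, ?_, ?_⟩
        · rw [Finset.sum_eq_single_of_mem α hα fun β _ hβ => by simp [hβ]]
          simp
        · rw [Finset.sum_eq_single_of_mem α hα fun β _ hβ => by simp [hβ]]
          simp
        · have := hA α hα
          simp only
          omega
    | zero => exact ⟨0, 0, by simp⟩
    | add u u' _ _ ih ih' =>
      obtain ⟨c, D, h1, h2, h3⟩ := ih
      obtain ⟨c', D', h1', h2', h3'⟩ := ih'
      refine ⟨c + c', D + D', ?_, ?_, ?_⟩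
      · simp [add_mul, Finset.sum_add_distrib, h1, h1']
      · simp [Finset.sum_add_distrib]
        omega
      · simp only [Prod.fst_add, Prod.snd_add, add_mul]
        omega
  · rintro ⟨h1, D, h2, h3⟩
    obtain ⟨c, hc, hd⟩ := exists_sum_eq_delta h1
    rw [hd] at h3
    -- A shortest expression of `u.1`, padded with copies of (0, d) up to `D` summands; the total
    -- then forces the second coordinate.
    have hu : u = ∑ α ∈ A, c α • ((α, d - α) : ℕ × ℕ) + (D - ∑ α ∈ A, c α) • ((0, d - 0)) := by
      have e1 : ∑ α ∈ A, c α * (d - α) + ∑ α ∈ A, c α * α = (∑ α ∈ A, c α) * d := by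
        rw [← Finset.sum_add_distrib, Finset.sum_mul]
        refine Finset.sum_congr rfl fun α hα => ?_
        rw [← mul_add, Nat.sub_add_cancel (hA α hα)]
      have e2 : (∑ α ∈ A, c α) * d + (D - ∑ α ∈ A, c α) * d = D * d := by
        rw [← add_mul, Nat.add_sub_cancel' h3]
      ext
      · simpa [Prod.fst_sum] using hc
      · simp [Prod.snd_sum]
        omega
    rw [hu]
    refine add_mem (sum_mem fun α hα => nsmul_mem (AddSubmonoid.subset_closure ?_) _)
      (nsmul_mem (AddSubmonoid.subset_closure ?_) _)
    · exact ⟨α, Set.mem_insert_of_mem _ hα, rfl⟩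
    · exact ⟨0, Set.mem_insert _ _, rfl⟩

end NumSgp

/-! ### The semigroup S, its enlargement S', and the points w i. -/

namespace MonomialCurve

variable {k : ℕ} {a : Fin (k + 1) → ℕ}

theorem mem_A1 {α : ℕ} : α ∈ A1 a ↔ α ≠ 0 ∧ ∃ j, a j = α := by simp [A1]

theorem mem_A2 {α : ℕ} : α ∈ A2 a ↔ α ≠ 0 ∧ ∃ j, d a - a j = α := by simp [A2]

theorem e_mem_S (j : Fin (k + 1)) : e a j ∈ S a := AddSubmonoid.subset_closure ⟨j, rfl⟩

theorem le_d (ha : StrictMono a) (j : Fin (k + 1)) : a j ≤ d a := ha.monotone (Fin.le_last j)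

theorem setGcd_A1 (hgcd : Finset.univ.gcd a = 1) : Nat.setGcd (A1 a : Set ℕ) = 1 := by
  rw [← Nat.dvd_one, ← hgcd]
  refine Finset.dvd_gcd fun j _ => ?_
  by_cases hj : a j = 0
  · simp [hj]
  · exact Nat.setGcd_dvd_of_mem (mem_A1.2 ⟨hj, j, rfl⟩)

theorem setGcd_A2 (ha : StrictMono a) (h0 : a 0 = 0) (hgcd : Finset.univ.gcd a = 1) :
    Nat.setGcd (A2 a : Set ℕ) = 1 := by
  have key (j) : Nat.setGcd (A2 a : Set ℕ) ∣ d a - a j := by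
    by_cases hj : d a - a j = 0
    · simp [hj]
    · exact Nat.setGcd_dvd_of_mem (mem_A2.2 ⟨hj, j, rfl⟩)
  rw [← Nat.dvd_one, ← hgcd]
  refine Finset.dvd_gcd fun j _ => ?_
  refine (Nat.dvd_add_right (key j)).1 ?_
  rw [Nat.sub_add_cancel (le_d ha j)]
  simpa [h0] using key 0

theorem mem_S_iff_delta1 (ha : StrictMono a) (h0 : a 0 = 0) {u : ℕ × ℕ} :
    u ∈ S a ↔ u.1 ∈ AddSubmonoid.closure (A1 a : Set ℕ) ∧
      ∃ D, u.1 + u.2 = D * d a ∧ delta1 a u ≤ D := by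
  rw [delta1, ← NumSgp.mem_closure_image_iff, S]
  · congr! 2
    ext v
    constructor
    · rintro ⟨j, rfl⟩
      refine ⟨a j, ?_, rfl⟩
      by_cases hj : a j = 0
      · exact Or.inl hj
      · exact Or.inr (mem_A1.2 ⟨hj, j, rfl⟩)
    · rintro ⟨α, rfl | hα, rfl⟩
      · exact ⟨0, by simp [e, h0]⟩
      · obtain ⟨-, j, rfl⟩ := mem_A1.1 hα
        exact ⟨j, rfl⟩
  · intro α hα
    obtain ⟨-, j, rfl⟩ := mem_A1.1 hα
    exact le_d ha j

/-- Swapping coordinates turns S into the semigroup of the points (α, d - α) with α ∈ A₂ ∪ {0}. -/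
theorem mem_S_iff_delta2 (ha : StrictMono a) {u : ℕ × ℕ} :
    u ∈ S a ↔ u.2 ∈ AddSubmonoid.closure (A2 a : Set ℕ) ∧
      ∃ D, u.1 + u.2 = D * d a ∧ delta2 a u ≤ D := by
  have h := NumSgp.mem_closure_image_iff (A := A2 a) (d := d a) (u := u.swap) (fun α hα => by
    obtain ⟨-, j, rfl⟩ := mem_A2.1 hα
    exact Nat.sub_le _ _)
  simp only [Prod.fst_swap, Prod.snd_swap, add_comm u.2 u.1] at h
  rw [delta2, ← h]
  have hS : AddSubmonoid.closure
      ((fun α => ((α, d a - α) : ℕ × ℕ)) '' (insert 0 (A2 a : Set ℕ))) =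
      (S a).map (AddEquiv.prodComm : ℕ × ℕ ≃+ ℕ × ℕ).toAddMonoidHom := by
    rw [S, AddMonoidHom.map_mclosure]
    congr 1
    ext v
    constructor
    · rintro ⟨α, rfl | hα, rfl⟩
      · exact ⟨_, ⟨Fin.last k, rfl⟩, by simp [e]⟩
      · obtain ⟨-, j, rfl⟩ := mem_A2.1 hα
        refine ⟨_, ⟨j, rfl⟩, ?_⟩
        simp [e, Nat.sub_sub_self (le_d ha j)]
    · rintro ⟨_, ⟨j, rfl⟩, rfl⟩
      refine ⟨d a - a j, ?_, by simp [e, Nat.sub_sub_self (le_d ha j)]⟩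
      by_cases hj : d a - a j = 0
      · exact Or.inl hj
      · exact Or.inr (mem_A2.2 ⟨hj, j, rfl⟩)
  rw [hS]
  constructor
  · intro hu
    exact ⟨u, hu, rfl⟩
  · rintro ⟨v, hv, hvu⟩
    have : v = u := by
      have := congrArg Prod.swap hvu
      simpa using this
    exact this ▸ hv

/-- The points `u` such that both `u + n e₀` and `u + n e_k` lie in `S` for some `n`. -/
def S' (a : Fin (k + 1) → ℕ) : Set (ℕ × ℕ) :=
  {u | u.1 ∈ AddSubmonoid.closure (A1 a : Set ℕ) ∧ u.2 ∈ AddSubmonoid.closure (A2 a : Set ℕ) ∧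
    d a ∣ u.1 + u.2}

theorem d_pos (ha : StrictMono a) (hk : 1 ≤ k) : 0 < d a :=
  (Nat.zero_le _).trans_lt (ha (show (0 : Fin (k + 1)) < Fin.last k from by
    rw [Fin.lt_def]; simpa using Nat.lt_of_lt_of_le Nat.zero_lt_one hk))

theorem d_mem_A1 (hd : 0 < d a) : d a ∈ A1 a := mem_A1.2 ⟨hd.ne', _, rfl⟩

theorem d_mem_A2 (h0 : a 0 = 0) (hd : 0 < d a) : d a ∈ A2 a :=
  mem_A2.2 ⟨hd.ne', 0, by simp [h0]⟩

theorem mem_S'_of_mem_S (ha : StrictMono a) (h0 : a 0 = 0) {u : ℕ × ℕ} (hu : u ∈ S a) :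
    u ∈ S' a := by
  obtain ⟨h1, D, hD, -⟩ := (mem_S_iff_delta1 ha h0).1 hu
  exact ⟨h1, ((mem_S_iff_delta2 ha).1 hu).1, D, by rw [hD, mul_comm]⟩

theorem not_mem_S_iff_delta1 (ha : StrictMono a) (h0 : a 0 = 0) (hd : 0 < d a) {u : ℕ × ℕ}
    (h1 : u.1 ∈ AddSubmonoid.closure (A1 a : Set ℕ)) {D : ℕ} (hD : u.1 + u.2 = D * d a) :
    u ∉ S a ↔ D < delta1 a u := by
  rw [← not_le, mem_S_iff_delta1 ha h0, not_iff_not]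
  constructor
  · rintro ⟨-, D', hD', h⟩
    rwa [Nat.eq_of_mul_eq_mul_right hd (hD.symm.trans hD')]
  · exact fun h => ⟨h1, D, hD, h⟩

theorem not_mem_S_iff_delta2 (ha : StrictMono a) (hd : 0 < d a) {u : ℕ × ℕ}
    (h2 : u.2 ∈ AddSubmonoid.closure (A2 a : Set ℕ)) {D : ℕ} (hD : u.1 + u.2 = D * d a) :
    u ∉ S a ↔ D < delta2 a u := by
  rw [← not_le, mem_S_iff_delta2 ha, not_iff_not]
  constructor
  · rintro ⟨-, D', hD', h⟩
    rwa [Nat.eq_of_mul_eq_mul_right hd (hD.symm.trans hD')]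
  · exact fun h => ⟨h2, D, hD, h⟩

theorem deg_eq (hd : 0 < d a) {u : ℕ × ℕ} {D : ℕ} (hD : u.1 + u.2 = D * d a) :
    deg a u = D := by
  have : (d a : ℝ) ≠ 0 := by exact_mod_cast hd.ne'
  rw [deg, div_eq_iff this]
  exact_mod_cast hD

theorem w_mem_S' (ha : StrictMono a) (h0 : a 0 = 0) (hgcd : Finset.univ.gcd a = 1)
    (hd : 0 < d a) {i : ℕ} (hi : i ≤ d a) : w a i ∈ S' a := by
  obtain ⟨h1, h1'⟩ := NumSgp.omega_mem (setGcd_A1 hgcd) hd i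
  obtain ⟨h2, h2'⟩ := NumSgp.omega_mem (setGcd_A2 ha h0 hgcd) hd (d a - i)
  refine ⟨h1, h2, ?_⟩
  have h := h1'.add h2'
  rw [Nat.add_sub_cancel' hi] at h
  exact (h.dvd_iff dvd_rfl).2 dvd_rfl

/-- The condition that i differs from every a j is redundant: for 1 ≤ a j < d the point w (a j) is
the generator e j, which lies in S. -/
theorem mem_I_iff (ha : StrictMono a) (h0 : a 0 = 0) (hgcd : Finset.univ.gcd a = 1)
    (hd : 0 < d a) {i : ℕ} : i ∈ I a ↔ 1 ≤ i ∧ i < d a ∧ w a i ∉ S a := by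
  rw [I, Finset.mem_filter, Finset.mem_Icc, and_assoc]
  constructor
  · rintro ⟨h1, h2, -, h3⟩
    have hi : i < d a := by omega
    refine ⟨h1, hi, ?_⟩
    have hw := w_mem_S' ha h0 hgcd hd hi.le
    obtain ⟨D, hD⟩ := hw.2.2
    rw [mul_comm] at hD
    rw [not_mem_S_iff_delta1 ha h0 hd hw.1 hD]
    rw [deg_eq hd hD] at h3
    exact_mod_cast h3
  · rintro ⟨h1, hi, h3⟩
    have hw := w_mem_S' ha h0 hgcd hd hi.le
    obtain ⟨D, hD⟩ := hw.2.2
    rw [mul_comm] at hD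
    refine ⟨h1, by omega, ?_, ?_⟩
    · rintro j rfl
      apply h3
      have : w a (a j) = e a j := by
        rw [w, NumSgp.omega_eq_self (mem_A1.2 ⟨by omega, j, rfl⟩) hi (setGcd_A1 hgcd),
          NumSgp.omega_eq_self (mem_A2.2 ⟨by omega, j, rfl⟩) (by omega) (setGcd_A2 ha h0 hgcd)]
        rfl
      rw [this]
      exact AddSubmonoid.subset_closure ⟨j, rfl⟩
    · rw [not_mem_S_iff_delta1 ha h0 hd hw.1 hD] at h3
      rw [deg_eq hd hD]
      exact_mod_cast h3

theorem e_zero (h0 : a 0 = 0) : e a 0 = (0, d a) := by simp [e, h0]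

theorem e_last : e a (Fin.last k) = (d a, 0) := by simp [e]

/-- Every point of `S' \ S` is `w i + α e_k + β e₀` for some `i ∈ 𝕀`. -/
theorem exists_eq_w_add (ha : StrictMono a) (h0 : a 0 = 0) (hgcd : Finset.univ.gcd a = 1)
    (hd : 0 < d a) {u : ℕ × ℕ} (hu : u ∈ S' a) (huS : u ∉ S a) :
    ∃ i ∈ I a, ∃ α β : ℕ, u.1 = (w a i).1 + α * d a ∧ u.2 = (w a i).2 + β * d a := by
  obtain ⟨h1, h2, h3⟩ := hu
  have hS (i α β : ℕ) (hα : u.1 = (w a i).1 + α * d a) (hβ : u.2 = (w a i).2 + β * d a) :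
      w a i ∉ S a := by
    intro hw
    apply huS
    have : u = w a i + α • e a (Fin.last k) + β • e a 0 := by
      rw [e_last, e_zero h0]
      ext <;> simp [hα, hβ]
    rw [this]
    exact add_mem (add_mem hw (nsmul_mem (e_mem_S _) _))
      (nsmul_mem (e_mem_S _) _)
  have hi : u.1 % d a < d a := Nat.mod_lt _ hd
  have hdiv := Nat.div_add_mod u.1 (d a)
  have hu2 : u.2 ≡ d a - u.1 % d a [MOD d a] := by
    refine Nat.ModEq.add_left_cancel (Nat.mod_modEq u.1 (d a)).symm ?_
    rw [Nat.add_sub_cancel' hi.le]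
    exact ((Nat.modEq_zero_iff_dvd.2 h3)).trans (Nat.modEq_zero_iff_dvd.2 dvd_rfl).symm
  have e1 := NumSgp.omega_le h1 (Nat.mod_modEq u.1 (d a)).symm
  have e2 := NumSgp.omega_le h2 hu2
  obtain ⟨-, f1⟩ := NumSgp.omega_mem (setGcd_A1 hgcd) hd (u.1 % d a)
  obtain ⟨-, f2⟩ := NumSgp.omega_mem (setGcd_A2 ha h0 hgcd) hd (d a - u.1 % d a)
  obtain ⟨α, hα⟩ := (Nat.modEq_iff_dvd' e1).1 (f1.trans (Nat.mod_modEq u.1 (d a)))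
  obtain ⟨β, hβ⟩ := (Nat.modEq_iff_dvd' e2).1 (f2.trans hu2.symm)
  rw [mul_comm] at hα hβ
  have hα' : u.1 = (w a (u.1 % d a)).1 + α * d a := by
    rw [← hα]; exact (Nat.add_sub_cancel' e1).symm
  have hβ' : u.2 = (w a (u.1 % d a)).2 + β * d a := by
    rw [← hβ]; exact (Nat.add_sub_cancel' e2).symm
  refine ⟨u.1 % d a, (mem_I_iff ha h0 hgcd hd).2 ⟨?_, hi, hS _ α β hα' hβ'⟩, α, β, hα', hβ'⟩
  -- Residue 0 is excluded: both coordinates would be multiples of d, and u a combination of e_k and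
  -- e₀.
  by_contra hz
  have hz : u.1 % d a = 0 := by omega
  apply huS
  have hu1 : d a ∣ u.1 := Nat.dvd_of_mod_eq_zero hz
  obtain ⟨p, hp⟩ := hu1
  obtain ⟨q, hq⟩ := (Nat.dvd_add_right ⟨p, hp⟩).1 h3
  have : u = p • e a (Fin.last k) + q • e a 0 := by
    rw [e_last, e_zero h0]
    ext
    · simp [hp, mul_comm]
    · simp [hq, mul_comm]
  rw [this]
  exact add_mem (nsmul_mem (e_mem_S _) _)
    (nsmul_mem (e_mem_S _) _)

end MonomialCurve

/-! ### Čech cocycles over a domain. -/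

namespace Cech

variable {R : Type*} [CommRing R] {ι : Type*} [LinearOrder ι] {x : ι → R}

theorem awayMap_algebraMap {f g : R} (h : f ∣ g) (r : R) :
    awayMap h (algebraMap R (Localization.Away f) r) = algebraMap R (Localization.Away g) r :=
  (awayMap h).commutes r

theorem mem_ker_d1_iff {c : ∀ i, Localization.Away (x i)} :
    c ∈ LinearMap.ker (d1 x) ↔ ∀ i j, i < j →
      awayMap (dvd_mul_left (x j) (x i)) (c j) = awayMap (dvd_mul_right (x i) (x j)) (c i) := by
  rw [LinearMap.mem_ker, funext_iff]
  constructor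
  · intro h i j hij
    exact sub_eq_zero.1 (h ⟨(i, j), hij⟩)
  · rintro h ⟨⟨i, j⟩, hij⟩
    exact sub_eq_zero.2 (h i j hij)

section Graded

variable {σ : Type*} [SetLike σ R] [AddSubgroupClass σ R] {𝒜 : ℤ → σ} [SetLike.GradedMonoid 𝒜]
  {e : ι → ℤ}

theorem H1Piece_ne_bot_iff (hx : ∀ i, x i ∈ 𝒜 (e i)) (n : ℤ) :
    H1Piece x 𝒜 hx n ≠ ⊥ ↔ ∃ c ∈ LinearMap.ker (d1 x),
      (∀ i, c i ∈ awayPiece 𝒜 (hx i) n) ∧ c ∉ LinearMap.range (d0 x) := by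
  rw [AddSubgroup.ne_bot_iff_exists_ne_zero]
  constructor
  · rintro ⟨⟨_, ⟨c, hc, rfl⟩⟩, hne⟩
    refine ⟨c, c.2, fun i => hc i trivial, fun h => hne ?_⟩
    ext
    exact (Submodule.Quotient.mk_eq_zero _).2 h
  · rintro ⟨c, hc, hn, hr⟩
    refine ⟨⟨_, ⟨⟨c, hc⟩, fun i _ => hn i, rfl⟩⟩, fun h => hr ?_⟩
    exact (Submodule.Quotient.mk_eq_zero
      ((LinearMap.range (d0 x)).comap (LinearMap.ker (d1 x)).subtype)).1 (congrArg Subtype.val h)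

end Graded

theorem eq_of_mul_pow_eq {f : R} {z w : Localization.Away f} {m : ℕ}
    (h : z * algebraMap R (Localization.Away f) (f ^ m) =
      w * algebraMap R (Localization.Away f) (f ^ m)) : z = w := by
  have hu : IsUnit (algebraMap R (Localization.Away f) (f ^ m)) := by
    rw [map_pow]
    exact (IsLocalization.Away.algebraMap_isUnit f).pow m
  exact hu.mul_right_cancel h

variable [IsDomain R]

theorem algebraMap_away_injective {f : R} (hf : f ≠ 0) :
    Function.Injective (algebraMap R (Localization.Away f)) :=
  IsLocalization.injective _ (powers_le_nonZeroDivisors_of_noZeroDivisors hf)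

/-- Over a domain R embeds in R_h, so the agreement of two fractions on the overlap can be
cross-multiplied in R itself. -/
theorem mul_pow_eq_mul_pow_of_awayMap_eq {f g h : R} (hf : f ∣ h) (hg : g ∣ h) (hh : h ≠ 0)
    {z : Localization.Away f} {w : Localization.Away g} (hzw : awayMap hf z = awayMap hg w)
    {r s : R} {m n : ℕ}
    (hz : z * algebraMap R (Localization.Away f) (f ^ m) = algebraMap R (Localization.Away f) r)
    (hw : w * algebraMap R (Localization.Away g) (g ^ n) = algebraMap R (Localization.Away g) s) :
    r * g ^ n = s * f ^ m := by
  apply algebraMap_away_injective hh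
  have hz' := congrArg (awayMap hf) hz
  have hw' := congrArg (awayMap hg) hw
  rw [map_mul, awayMap_algebraMap, awayMap_algebraMap] at hz' hw'
  rw [map_mul, map_mul, ← hz', ← hw', hzw]
  ring

end Cech

/-! ### Graded pieces of H¹ and the points of S' \ S. -/

namespace MonomialCurve

variable {k : ℕ} {a : Fin (k + 1) → ℕ} {K : Type*} [Field K]

instance : IsDomain (Ring a K) :=
  haveI : UniqueSums (S a) := UniqueSums.of_injective_addHom (S a).subtype.toAddHom
    Subtype.val_injective inferInstance
  inferInstance

variable (K) in
/-- The monomial of `K[S]` with exponent `u`. -/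
def mono {u : ℕ × ℕ} (hu : u ∈ S a) : Ring a K := AddMonoidAlgebra.single ⟨u, hu⟩ 1

theorem gen_pow (j : Fin (k + 1)) (m : ℕ) :
    gen a K j ^ m = mono K (nsmul_mem (e_mem_S j) m) := by
  rw [gen, AddMonoidAlgebra.single_pow, one_pow]
  rfl

theorem gen_ne_zero (j : Fin (k + 1)) : gen a K j ≠ 0 := by
  simp [gen]

theorem mono_mul_mono {u v w : ℕ × ℕ} (hu : u ∈ S a) (hv : v ∈ S a) (hw : w ∈ S a)
    (h : u + v = w) : mono K hu * mono K hv = mono K hw := by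
  subst h
  rw [mono, mono, AddMonoidAlgebra.single_mul_single, one_mul]
  rfl

theorem mono_mem_grading {u : ℕ × ℕ} (hu : u ∈ S a) {n : ℤ} (h : deg a u = n) :
    mono K hu ∈ grading a K n := by
  have h1 := AddMonoidAlgebra.single_mem_gradeBy (fun u : S a => deg a (u : ℕ × ℕ))
    ⟨u, hu⟩ (1 : K)
  simp only [h] at h1
  exact h1

theorem deg_eq_of_mem_support {n : ℤ} {p : Ring a K} (hp : p ∈ grading a K n) {u : S a}
    (hu : p.coeff u ≠ 0) : deg a u = n :=
  (AddMonoidAlgebra.mem_gradeBy_iff _ _ _ _).1 hp (Finsupp.mem_support_iff.2 hu)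

theorem deg_add (u v : ℕ × ℕ) : deg a (u + v) = deg a u + deg a v := by
  simp [deg]; ring

theorem deg_nsmul (n : ℕ) (u : ℕ × ℕ) : deg a (n • u) = n * deg a u := by
  simp [deg]; ring

theorem deg_e (ha : StrictMono a) (hd : 0 < d a) (j : Fin (k + 1)) : deg a (e a j) = 1 := by
  have := deg_eq (a := a) hd (u := e a j) (D := 1)
    (by rw [one_mul]; exact Nat.add_sub_cancel' (le_d ha j))
  simpa using this

/-- For `u ∈ S'`, some `u + m e_j` lies in `S`. -/
theorem exists_add_nsmul_e_mem_S (ha : StrictMono a) (h0 : a 0 = 0) {u : ℕ × ℕ}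
    (hu : u ∈ S' a) (j : Fin (k + 1)) : ∃ m : ℕ, u + m • e a j ∈ S a := by
  obtain ⟨h1, h2, D, hD⟩ := hu
  rw [mul_comm] at hD
  by_cases hj : a j = d a
  -- Adding e_k keeps the second coordinate, hence δ₂, while the degree grows to at least δ₂.
  · refine ⟨delta2 a u, (mem_S_iff_delta2 ha).2 ⟨?_, D + delta2 a u, ?_, ?_⟩⟩
    · simpa [e, hj] using h2
    · simp [e, hj, add_mul]
      omega
    · simp [delta2, e, hj]
  · -- `d e_j = (d - a j) e_0 + (a j) e_k`
    have hlt : a j < d a := lt_of_le_of_ne (le_d ha j) hj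
    have hS : u + delta1 a u • e a 0 ∈ S a := by
      refine (mem_S_iff_delta1 ha h0).2 ⟨?_, D + delta1 a u, ?_, ?_⟩
      · simpa [e, h0] using h1
      · simp [e, h0, add_mul]
        omega
      · simp [delta1, e, h0]
    -- As a j < d, each block of d copies of e_j contains at least one e₀, and δ₁(u) copies of e₀
    -- suffice.
    refine ⟨delta1 a u * d a, ?_⟩
    have : u + (delta1 a u * d a) • e a j = u + delta1 a u • e a 0 +
        (delta1 a u * (d a - a j - 1)) • e a 0 + (delta1 a u * a j) • e a (Fin.last k) := by
      obtain ⟨q, hq⟩ := Nat.exists_eq_add_of_lt hlt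
      have hq' : d a - a j = q + 1 := by omega
      rw [e_last, e_zero h0, hq', e, hq']
      ext
      · simp; ring
      · simp; ring
    rw [this]
    exact add_mem (add_mem hS (nsmul_mem (e_mem_S _) _)) (nsmul_mem (e_mem_S _) _)

/-- Adding e₀ does not affect the first coordinate, and adding e_k does not affect the second. -/
theorem mem_S'_of_add_mem (ha : StrictMono a) (h0 : a 0 = 0) {u : ℕ × ℕ} {m n : ℕ}
    (h1 : u + m • e a 0 ∈ S a) (h2 : u + n • e a (Fin.last k) ∈ S a) : u ∈ S' a := by
  have h1' := mem_S'_of_mem_S ha h0 h1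
  have h2' := mem_S'_of_mem_S ha h0 h2
  rw [e_zero h0] at h1'
  rw [e_last] at h2'
  refine ⟨by simpa using h1'.1, by simpa using h2'.2.1, ?_⟩
  have := h1'.2.2
  simp only [Prod.fst_add, Prod.snd_add, Prod.smul_fst, Prod.smul_snd, smul_eq_mul, mul_zero,
    add_zero] at this
  rw [← add_assoc] at this
  exact (Nat.dvd_add_left (dvd_mul_left _ _)).1 this

theorem gen_pow_dvd {p : Ring a K} {j : Fin (k + 1)} {m : ℕ}
    (h : ∀ v : S a, p.coeff v ≠ 0 → ∃ u ∈ S a, (v : ℕ × ℕ) = u + m • e a j) :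
    gen a K j ^ m ∣ p := by
  rw [gen_pow, mono, ← AddMonoidAlgebra.of'_apply, AddMonoidAlgebra.of'_dvd_iff_modOf_eq_zero]
  ext v
  by_cases hv : ∃ w, v = (⟨m • e a j, nsmul_mem (e_mem_S j) m⟩ : S a) + w
  · rw [AddMonoidAlgebra.coeff_modOf_of_exists_add _ _ _ hv]; rfl
  · rw [AddMonoidAlgebra.coeff_modOf_of_not_exists_add _ _ _ hv]
    by_contra hne
    obtain ⟨u, hu, huv⟩ := h v hne
    exact hv ⟨⟨u, hu⟩, Subtype.ext (by rw [huv, add_comm]; rfl)⟩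

/-- The Laurent monomial with exponent u lies in every localization at a generator, so it defines a
cocycle; were it the image of an element of K[S], then u would lie in S. -/
theorem H1Piece_ne_bot (ha : StrictMono a) (h0 : a 0 = 0) (hk : 1 ≤ k) {u : ℕ × ℕ}
    (hu : u ∈ S' a) (huS : u ∉ S a) {n : ℤ} (hn : deg a u = n) :
    Cech.H1Piece (gen a K) (grading a K) (fun j => gen_mem K ha h0 hk j) n ≠ ⊥ := by
  have hd := d_pos ha hk
  choose m hm using exists_add_nsmul_e_mem_S ha h0 hu
  have hunit (j : Fin (k + 1)) :
      IsUnit (algebraMap (Ring a K) (Localization.Away (gen a K j)) (gen a K j ^ m j)) := by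
    rw [map_pow]
    exact (IsLocalization.Away.algebraMap_isUnit _).pow _
  have hc (j) : ∃ z : Localization.Away (gen a K j), z * algebraMap _ _ (gen a K j ^ m j) =
      algebraMap _ _ (mono K (hm j)) := by
    obtain ⟨v, hv⟩ := (hunit j).exists_left_inv
    exact ⟨algebraMap _ _ (mono K (hm j)) * v, by rw [mul_assoc, hv, mul_one]⟩
  choose c hc using hc
  rw [Cech.H1Piece_ne_bot_iff]
  refine ⟨c, Cech.mem_ker_d1_iff.2 fun i j _ => ?_, fun j => ⟨m j, _, ?_, hc j⟩, ?_⟩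
  · have hi := congrArg (Cech.awayMap (dvd_mul_right (gen a K i) (gen a K j))) (hc i)
    have hj := congrArg (Cech.awayMap (dvd_mul_left (gen a K j) (gen a K i))) (hc j)
    rw [map_mul, Cech.awayMap_algebraMap, Cech.awayMap_algebraMap] at hi hj
    have ui := (hunit i).map (Cech.awayMap (dvd_mul_right (gen a K i) (gen a K j)))
    have uj := (hunit j).map (Cech.awayMap (dvd_mul_left (gen a K j) (gen a K i)))
    rw [Cech.awayMap_algebraMap] at ui uj
    -- After clearing both denominators each side is the monomial with exponent u + m_i e_i + m_j
    -- e_j.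
    refine (ui.mul uj).mul_right_cancel ?_
    rw [← mul_assoc, mul_right_comm, hj, ← mul_assoc, hi, ← map_mul, ← map_mul, gen_pow, gen_pow]
    have hS : u + m i • e a i + m j • e a j ∈ S a := add_mem (hm i) (nsmul_mem (e_mem_S _) _)
    rw [mono_mul_mono (hm i) _ hS rfl, mono_mul_mono (hm j) _ hS (add_right_comm _ _ _)]
  · refine mono_mem_grading _ ?_
    rw [deg_add, deg_nsmul, deg_e ha hd, hn]
    push_cast
    ring
  · rintro ⟨r, hr⟩
    have h := hc 0
    rw [← hr] at h
    change algebraMap _ _ r * _ = _ at h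
    rw [← map_mul] at h
    have h := Cech.algebraMap_away_injective (gen_ne_zero 0) h
    rw [gen_pow] at h
    have hdvd : AddMonoidAlgebra.of' K (S a) ⟨m 0 • e a 0, nsmul_mem (e_mem_S 0) _⟩ ∣
        mono K (hm 0) := ⟨r, by rw [mul_comm]; exact h.symm⟩
    rw [AddMonoidAlgebra.of'_dvd_iff_modOf_eq_zero] at hdvd
    have h1 := congrArg (fun p => p.coeff (⟨_, hm 0⟩ : S a)) hdvd
    by_cases hv : ∃ w, (⟨_, hm 0⟩ : S a) = (⟨m 0 • e a 0, nsmul_mem (e_mem_S 0) (m 0)⟩ : S a) + w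
    · obtain ⟨w, hw⟩ := hv
      have hw' : u + m 0 • e a 0 = m 0 • e a 0 + (w : ℕ × ℕ) := congrArg Subtype.val hw
      rw [add_comm] at hw'
      exact huS (add_left_cancel hw' ▸ w.2)
    · simp only [AddMonoidAlgebra.coeff_modOf_of_not_exists_add _ _ _ hv] at h1
      simp [mono] at h1

/-- Contrapositive. Comparing the entries at e₀ and e_k shows that every exponent of the entry at e₀
lies in S' and has degree n. If all these lie in S, that entry comes from some r in K[S], and the
cocycle condition makes every other entry equal to r. -/
theorem exists_mem_S'_of_H1Piece_ne_bot (ha : StrictMono a) (h0 : a 0 = 0) (hk : 1 ≤ k) {n : ℤ}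
    (hne : Cech.H1Piece (gen a K) (grading a K) (fun j => gen_mem K ha h0 hk j) n ≠ ⊥) :
    ∃ u ∈ S' a, u ∉ S a ∧ deg a u = n := by
  have hd := d_pos ha hk
  rw [Cech.H1Piece_ne_bot_iff] at hne
  obtain ⟨c, hc, hn, hr⟩ := hne
  by_contra! hcon
  apply hr
  have hc' := Cech.mem_ker_d1_iff.1 hc
  obtain ⟨m, p, hp, hpc⟩ := hn 0
  obtain ⟨m', q, hq, hqc⟩ := hn (Fin.last k)
  have hlast : (0 : Fin (k + 1)) < Fin.last k := by
    rw [Fin.lt_def]; simpa using Nat.lt_of_lt_of_le Nat.zero_lt_one hk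
  have hpq := Cech.mul_pow_eq_mul_pow_of_awayMap_eq _ _ (mul_ne_zero (gen_ne_zero _) (gen_ne_zero _))
    (hc' 0 (Fin.last k) hlast) hqc hpc
  -- `q x₀ ^ m = p x_k ^ m'`
  have hdvd : gen a K 0 ^ m ∣ p := by
    refine gen_pow_dvd fun v hv => ?_
    have h1 : (p * gen a K (Fin.last k) ^ m').coeff
        (v + ⟨m' • e a (Fin.last k), nsmul_mem (e_mem_S _) _⟩) ≠ 0 := by
      rw [gen_pow, mono, AddMonoidAlgebra.coeff_mul_single_add, mul_one]
      exact hv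
    rw [← hpq, gen_pow, mono] at h1
    have h2 : ∃ v' : S a, v' + ⟨m • e a 0, nsmul_mem (e_mem_S _) _⟩ =
      v + ⟨m' • e a (Fin.last k), nsmul_mem (e_mem_S _) _⟩ := by
      by_contra! hno
      exact h1 (AddMonoidAlgebra.coeff_mul_single_of_forall_add_ne _ _ hno)
    obtain ⟨v', hv'⟩ := h2
    have hv' : (v' : ℕ × ℕ) + m • e a 0 = v + m' • e a (Fin.last k) := congrArg Subtype.val hv'
    -- Since e_k has second coordinate 0, the m copies of e₀ must be absorbed by v.
    have hv2 : m * d a ≤ (v : ℕ × ℕ).2 := by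
      have := congrArg Prod.snd hv'
      simp [e_zero h0, e_last] at this
      omega
    obtain ⟨u, hu⟩ : ∃ u : ℕ × ℕ, (v : ℕ × ℕ) = u + m • e a 0 := by
      refine ⟨((v : ℕ × ℕ).1, (v : ℕ × ℕ).2 - m * d a), ?_⟩
      rw [e_zero h0]
      ext
      · simp
      · simp [Nat.sub_add_cancel hv2]
    have hu' : (v' : ℕ × ℕ) = u + m' • e a (Fin.last k) := by
      rw [hu, add_right_comm] at hv'
      exact add_right_cancel hv'
    have huS' : u ∈ S' a := mem_S'_of_add_mem ha h0 (hu ▸ v.2) (hu' ▸ v'.2)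
    refine ⟨u, ?_, hu⟩
    by_contra huS
    refine hcon u huS' huS ?_
    have := deg_eq_of_mem_support hp hv
    rw [hu, deg_add, deg_nsmul, deg_e ha hd] at this
    push_cast at this
    linarith
  obtain ⟨r, rfl⟩ := hdvd
  have hc0 : c 0 = algebraMap _ _ r := Cech.eq_of_mul_pow_eq (hpc.trans (by rw [map_mul, mul_comm]))
  refine ⟨r, funext fun j => ?_⟩
  change algebraMap _ _ r = c j
  rcases (Fin.zero_le j).eq_or_lt with rfl | hj
  · exact hc0.symm
  · obtain ⟨l, s, -, hs⟩ := hn j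
    have h := Cech.mul_pow_eq_mul_pow_of_awayMap_eq _ _
      (mul_ne_zero (gen_ne_zero _) (gen_ne_zero _)) (hc' 0 j hj) hs
      -- Exponent 0 is allowed here since `c 0` has no denominator.
      (show c 0 * algebraMap _ _ (gen a K 0 ^ 0) = algebraMap _ _ r by simp [hc0])
    rw [pow_zero, mul_one] at h
    refine Cech.eq_of_mul_pow_eq (m := l) ?_
    rw [hs, h, map_mul]

end MonomialCurve

/-! ### The bounds on a₁(K[S]). -/

namespace MonomialCurve

variable {k : ℕ} {a : Fin (k + 1) → ℕ} {K : Type*} [Field K]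

theorem deg_le_aOne (ha : StrictMono a) (h0 : a 0 = 0) (hk : 1 ≤ k) {u : ℕ × ℕ}
    (hu : u ∈ S' a) (huS : u ∉ S a) {D : ℕ} (hD : u.1 + u.2 = D * d a) :
    ((D : ℝ) : EReal) ≤ aOne K ha h0 hk :=
  le_sSup ⟨D, H1Piece_ne_bot ha h0 hk hu huS (by rw [deg_eq (d_pos ha hk) hD]; simp), by simp⟩

theorem aOne_le (ha : StrictMono a) (h0 : a 0 = 0) (hk : 1 ≤ k) {b : ℝ}
    (hb : ∀ u ∈ S' a, u ∉ S a → deg a u ≤ b) : aOne K ha h0 hk ≤ (b : EReal) := by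
  refine sSup_le ?_
  rintro _ ⟨n, hn, rfl⟩
  obtain ⟨u, hu, huS, hun⟩ := exists_mem_S'_of_H1Piece_ne_bot ha h0 hk hn
  rw [← hun]
  exact_mod_cast hb u hu huS

theorem exists_deg_w (ha : StrictMono a) (h0 : a 0 = 0) (hgcd : Finset.univ.gcd a = 1)
    (hd : 0 < d a) {i : ℕ} (hi : i ∈ I a) : w a i ∈ S' a ∧ ∃ D, (w a i).1 + (w a i).2 = D * d a ∧
      D < delta1 a (w a i) ∧ D < delta2 a (w a i) := by
  obtain ⟨-, hi, hw⟩ := (mem_I_iff ha h0 hgcd hd).1 hi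
  have hS := w_mem_S' ha h0 hgcd hd hi.le
  obtain ⟨D, hD⟩ := hS.2.2
  rw [mul_comm] at hD
  exact ⟨hS, D, hD, (not_mem_S_iff_delta1 ha h0 hd hS.1 hD).1 hw,
    (not_mem_S_iff_delta2 ha hd hS.2.1 hD).1 hw⟩

theorem delta1_w_le_aOne (ha : StrictMono a) (h0 : a 0 = 0) (hgcd : Finset.univ.gcd a = 1)
    (hk : 1 ≤ k) {i : ℕ} (hi : i ∈ I a) :
    (((delta1 a (w a i) : ℝ) - 1 : ℝ) : EReal) ≤ aOne K ha h0 hk := by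
  have hd := d_pos ha hk
  obtain ⟨⟨h1, h2, h3⟩, D, hD, hD1, -⟩ := exists_deg_w ha h0 hgcd hd hi
  -- Here q = δ₁(w i) - 1 - D is the largest number of copies of e₀ that keeps the point outside S.
  obtain ⟨q, hq⟩ := Nat.exists_eq_add_of_lt hD1
  have hu : ((w a i).1, (w a i).2 + q * d a).1 + ((w a i).1, (w a i).2 + q * d a).2 =
      (D + q) * d a := by
    rw [add_mul, ← hD, add_assoc]
  have h := deg_le_aOne (K := K) ha h0 hk (u := ((w a i).1, (w a i).2 + q * d a)) (D := D + q)
    ⟨h1, add_mem h2 ?_, (D + q), hu.trans (mul_comm _ _)⟩ ?_ hu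
  · rwa [hq, Nat.cast_succ, add_sub_cancel_right]
  · rw [← smul_eq_mul]
    exact nsmul_mem (AddSubmonoid.subset_closure (d_mem_A2 h0 hd)) _
  · rw [not_mem_S_iff_delta1 ha h0 hd (by exact h1) hu]
    change _ < delta1 a (w a i)
    omega

theorem delta2_w_le_aOne (ha : StrictMono a) (h0 : a 0 = 0) (hgcd : Finset.univ.gcd a = 1)
    (hk : 1 ≤ k) {i : ℕ} (hi : i ∈ I a) :
    (((delta2 a (w a i) : ℝ) - 1 : ℝ) : EReal) ≤ aOne K ha h0 hk := by
  have hd := d_pos ha hk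
  obtain ⟨⟨h1, h2, h3⟩, D, hD, -, hD2⟩ := exists_deg_w ha h0 hgcd hd hi
  obtain ⟨q, hq⟩ := Nat.exists_eq_add_of_lt hD2
  have hu : ((w a i).1 + q * d a, (w a i).2).1 + ((w a i).1 + q * d a, (w a i).2).2 =
      (D + q) * d a := by
    rw [add_mul, ← hD, add_right_comm]
  have h := deg_le_aOne (K := K) ha h0 hk (u := ((w a i).1 + q * d a, (w a i).2)) (D := D + q)
    ⟨add_mem h1 ?_, h2, (D + q), hu.trans (mul_comm _ _)⟩ ?_ hu
  · rwa [hq, Nat.cast_succ, add_sub_cancel_right]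
  · rw [← smul_eq_mul]
    exact nsmul_mem (AddSubmonoid.subset_closure (d_mem_A1 hd)) _
  · rw [not_mem_S_iff_delta2 ha hd (by exact h2) hu]
    change _ < delta2 a (w a i)
    omega

/-- Write u = w i + α e_k + β e₀ and let D = deg (w i). Since δ₁ grows by at most α and δ₂ by at
most β, both D + β < δ₁(w i) and D + α < δ₂(w i); the two strict inequalities yield the 2. -/
theorem exists_deg_le (ha : StrictMono a) (h0 : a 0 = 0) (hgcd : Finset.univ.gcd a = 1)
    (hd : 0 < d a) {u : ℕ × ℕ} (hu : u ∈ S' a) (huS : u ∉ S a) :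
    ∃ i ∈ I a, deg a u ≤
      (delta1 a (w a i) : ℝ) + (delta2 a (w a i) : ℝ) - deg a (w a i) - 2 := by
  obtain ⟨i, hi, α, β, hα, hβ⟩ := exists_eq_w_add ha h0 hgcd hd hu huS
  obtain ⟨hw, D, hD, -, -⟩ := exists_deg_w ha h0 hgcd hd hi
  have hDu : u.1 + u.2 = (D + α + β) * d a := by
    rw [hα, hβ, add_mul, add_mul, ← hD]
    ring
  have h1 := (not_mem_S_iff_delta1 ha h0 hd hu.1 hDu).1 huS
  have h2 := (not_mem_S_iff_delta2 ha hd hu.2.1 hDu).1 huS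
  have h1' : delta1 a u ≤ delta1 a (w a i) + α := by
    rw [delta1, hα]
    exact NumSgp.delta_add_mul_le (d_mem_A1 hd) hw.1 α
  have h2' : delta2 a u ≤ delta2 a (w a i) + β := by
    rw [delta2, hβ]
    exact NumSgp.delta_add_mul_le (d_mem_A2 h0 hd) hw.2.1 β
  refine ⟨i, hi, ?_⟩
  rw [deg_eq hd hD, deg_eq hd hDu]
  have : D + α + β + D + 2 ≤ delta1 a (w a i) + delta2 a (w a i) := by omega
  have : (D + α + β + D + 2 : ℝ) ≤ delta1 a (w a i) + delta2 a (w a i) := by exact_mod_cast this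
  push_cast
  linarith

/-- After multiplying by d this is the sum of a₁ δ₁(u) ≤ u₁ and (d - a_{k-1}) δ₂(u) ≤ u₂, which hold
because a₁ and d - a_{k-1} are the least elements of A₁ and A₂. -/
theorem delta_add_sub_deg_le (ha : StrictMono a) (h0 : a 0 = 0) (hk : 2 ≤ k) {u : ℕ × ℕ} (hu : u ∈ S' a) :
    (delta1 a u : ℝ) + delta2 a u - deg a u ≤
      (1 - (a ⟨1, by omega⟩ : ℝ) / d a) * delta1 a u +
        (a ⟨k - 1, by omega⟩ : ℝ) / d a * delta2 a u := by
  have hd : 0 < d a := d_pos ha (by omega)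
  have h1 : a ⟨1, by omega⟩ * delta1 a u ≤ u.1 := by
    refine NumSgp.mul_delta_le (fun α hα => ?_) hu.1
    obtain ⟨hne, j, rfl⟩ := mem_A1.1 hα
    have hj : j ≠ 0 := by
      rintro rfl
      exact hne h0
    refine ha.monotone (Fin.le_def.2 ?_)
    exact Nat.one_le_iff_ne_zero.2 (Fin.val_ne_zero_iff.2 hj)
  have h2 : (d a - a ⟨k - 1, by omega⟩) * delta2 a u ≤ u.2 := by
    refine NumSgp.mul_delta_le (fun α hα => ?_) hu.2.1
    obtain ⟨hne, j, rfl⟩ := mem_A2.1 hα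
    refine Nat.sub_le_sub_left (ha.monotone ?_) _
    have : j ≠ Fin.last k := by
      rintro rfl
      exact hne (Nat.sub_self _)
    rw [Fin.le_def]
    have := Fin.val_lt_last this
    simp only
    omega
  have hd' : (0 : ℝ) < d a := by exact_mod_cast hd
  have h1 : (a ⟨1, by omega⟩ : ℝ) * delta1 a u ≤ u.1 := by exact_mod_cast h1
  have h2 : ((d a : ℝ) - a ⟨k - 1, by omega⟩) * delta2 a u ≤ u.2 := by
    rw [← Nat.cast_sub (le_d ha _)]
    exact_mod_cast h2
  rw [deg, ← sub_nonneg]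
  have : (1 - (a ⟨1, by omega⟩ : ℝ) / d a) * delta1 a u +
        (a ⟨k - 1, by omega⟩ : ℝ) / d a * delta2 a u -
      ((delta1 a u : ℝ) + delta2 a u - ((u.1 : ℝ) + u.2) / d a) =
      ((u.1 - a ⟨1, by omega⟩ * delta1 a u) +
        (u.2 - (d a - a ⟨k - 1, by omega⟩) * delta2 a u)) / d a := by
    field_simp
    ring
  rw [this]
  exact div_nonneg (by linarith) hd'.le

end MonomialCurve

end

theorem theorem4p6 (K : Type*) [Field K] (k : ℕ) (hk : 3 ≤ k) (a : Fin (k + 1) → ℕ)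
    (ha : StrictMono a) (h0 : a 0 = 0) (hgcd : Finset.univ.gcd a = 1)
    (hI : (MonomialCurve.I a).Nonempty) :
    ((((MonomialCurve.I a).sup' hI (fun i =>
          max (MonomialCurve.delta1 a (MonomialCurve.w a i) : ℝ)
            (MonomialCurve.delta2 a (MonomialCurve.w a i) : ℝ)) - 1 : ℝ) : EReal)
        ≤ MonomialCurve.aOne K ha h0 (by omega)) ∧
    (MonomialCurve.aOne K ha h0 (by omega) ≤
      (((MonomialCurve.I a).sup' hI (fun i =>
          (MonomialCurve.delta1 a (MonomialCurve.w a i) : ℝ)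
            + (MonomialCurve.delta2 a (MonomialCurve.w a i) : ℝ)
            - MonomialCurve.deg a (MonomialCurve.w a i)) - 2 : ℝ) : EReal)) ∧
    (MonomialCurve.aOne K ha h0 (by omega) ≤
      (((⌊(1 - (a ⟨1, by omega⟩ : ℝ) / (MonomialCurve.d a : ℝ)) *
            (MonomialCurve.I a).sup' hI
              (fun i => (MonomialCurve.delta1 a (MonomialCurve.w a i) : ℝ))
          + (a ⟨k - 1, by omega⟩ : ℝ) / (MonomialCurve.d a : ℝ) *
            (MonomialCurve.I a).sup' hI
              (fun i => (MonomialCurve.delta2 a (MonomialCurve.w a i) : ℝ))⌋ : ℝ) - 2 : ℝ)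
        : EReal)) := by
  have hd := MonomialCurve.d_pos ha (by omega : 1 ≤ k)
  refine ⟨?_, ?_, ?_⟩
  · obtain ⟨i, hi, h⟩ := Finset.exists_mem_eq_sup' hI (fun i =>
      max (MonomialCurve.delta1 a (MonomialCurve.w a i) : ℝ)
        (MonomialCurve.delta2 a (MonomialCurve.w a i) : ℝ))
    rw [h]
    rcases max_choice (MonomialCurve.delta1 a (MonomialCurve.w a i) : ℝ)
        (MonomialCurve.delta2 a (MonomialCurve.w a i) : ℝ) with h | h <;> rw [h]
    · exact MonomialCurve.delta1_w_le_aOne ha h0 hgcd _ hi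
    · exact MonomialCurve.delta2_w_le_aOne ha h0 hgcd _ hi
  · refine MonomialCurve.aOne_le ha h0 _ fun u hu huS => ?_
    obtain ⟨i, hi, h⟩ := MonomialCurve.exists_deg_le ha h0 hgcd hd hu huS
    have := Finset.le_sup' (fun i => (MonomialCurve.delta1 a (MonomialCurve.w a i) : ℝ)
            + (MonomialCurve.delta2 a (MonomialCurve.w a i) : ℝ)
            - MonomialCurve.deg a (MonomialCurve.w a i)) hi
    linarith
  · refine MonomialCurve.aOne_le ha h0 _ fun u hu huS => ?_
    obtain ⟨i, hi, h⟩ := MonomialCurve.exists_deg_le ha h0 hgcd hd hu huS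
    obtain ⟨hw, -⟩ := MonomialCurve.exists_deg_w ha h0 hgcd hd hi
    have hle := MonomialCurve.delta_add_sub_deg_le ha h0 (by omega) hw
    have s1 := Finset.le_sup' (fun i => (MonomialCurve.delta1 a (MonomialCurve.w a i) : ℝ)) hi
    have s2 := Finset.le_sup' (fun i => (MonomialCurve.delta2 a (MonomialCurve.w a i) : ℝ)) hi
    have hd' : (0 : ℝ) < MonomialCurve.d a := by exact_mod_cast hd
    -- Nonnegative coefficients allow δ₁ and δ₂ to be replaced by their separate maxima.
    have c1 : 0 ≤ 1 - (a ⟨1, by omega⟩ : ℝ) / (MonomialCurve.d a : ℝ) := by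
      rw [sub_nonneg, div_le_one hd']
      exact_mod_cast MonomialCurve.le_d ha _
    have c2 : 0 ≤ (a ⟨k - 1, by omega⟩ : ℝ) / (MonomialCurve.d a : ℝ) := by positivity
    have m1 := mul_le_mul_of_nonneg_left s1 c1
    have m2 := mul_le_mul_of_nonneg_left s2 c2
    obtain ⟨D, hD⟩ := hu.2.2
    rw [mul_comm] at hD
    rw [MonomialCurve.deg_eq hd hD] at h ⊢
    rw [le_sub_iff_add_le]
    -- The degree D of u is an integer, so the real bound on D + 2 passes to the floor.
    have key : ((D : ℤ) + 2 : ℤ) ≤ ⌊(1 - (a ⟨1, by omega⟩ : ℝ) / (MonomialCurve.d a : ℝ)) *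
            (MonomialCurve.I a).sup' hI
              (fun i => (MonomialCurve.delta1 a (MonomialCurve.w a i) : ℝ))
          + (a ⟨k - 1, by omega⟩ : ℝ) / (MonomialCurve.d a : ℝ) *
            (MonomialCurve.I a).sup' hI
              (fun i => (MonomialCurve.delta2 a (MonomialCurve.w a i) : ℝ))⌋ := by
      rw [Int.le_floor]
      push_cast
      linarith
    exact_mod_cast key
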